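/- **Setting.** Let $\{f_\theta\}$ be a family of probability densities with respect to a $\sigma$-finite measure on a measurable space, and for $k=1,\dots,K$ let $f_{\theta_{k,0}}$ and $f_{\theta_{k,1}}$ be the pre- and post-change densities of stream $k$. Under $P_\infty$ (no change ever occurs) the observations $X_{k,t}$ ($1\le k\le K$, $t\ge1$) are mutually independent and $X_{k,t}$ has density $f_{\theta_{k,0}}$. At each time $t\ge 1$ a set $S_t$ of exactly $q$ streams is observed, and with $R_{k,0}=0$, $L_{k,0}=1$ one puts $$R_{k,t}=(R_{k,t-1}+1)\Lambda_{k,t},\qquad L_{k,t}=L_{k,t-1}\Lambda_{k,t},\qquad \Lambda_{k,t}=\begin{cases} f_{\theta_{k,1}}(X_{k,t})/f_{\theta_{k,0}}(X_{k,t}), & k\in S_t,\\ 1,& k\notin S_t.\end{cases}$$ The initial layout $S_1$ is an arbitrary random set of $q$ streams. For $t\ge1$, fresh values $\tilde R_{k,t}$ are drawn independently from prior distributions $G_k$ on $\mathbb R$ (for instance one common $G$), independently of the past and of the observations at time $t$, and $S_{t+1}$ consists of $q$ streams with the largest values of $R^*_{k,t}=R_{k,t}+L_{k,t}\tilde R_{k,t}$.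 Layouts (in particular the choice of $S_1$ and the breaking of ties) do not anticipate the future: for some filtration $(\mathcal F_t)_{t\ge 0}$ to which the $X_{k,t}$ and $\tilde R_{k,t}$ are adapted, $S_{t+1}$ is $\mathcal F_t$-measurable and $(X_{k,t+1},\tilde R_{k,t+1})_{k\le K}$ is independent of $\mathcal F_t$. Let $R_{(1),t}\ge\dots\ge R_{(K),t}$ be the decreasing order of $R_{1,t},\dots,R_{K,t}$, let $1\le r\le K$, and for real $A$ let $$T=T_A=\inf\Big\{t\ge1:\ \sum_{k=1}^{r}R_{(k),t}\ge A\Big\},\qquad \inf\emptyset=\infty .$$ **Theorem 2 (Average run length to false alarm).** (i) $\mathbb E_\infty(T_A)\ge A/K$ for every $A$. (ii) If the Kullback–Leibler divergence of $f_{\theta_{k,1}}$ from $f_{\theta_{k,0}}$, that is $\int f_{\theta_{k,1}}\log(f_{\theta_{k,1}}/f_{\theta_{k,0}})$ (understood as $+\infty$ when $f_{\theta_{k,1}}$ is not absolutely continuous with respect to $f_{\theta_{k,0}}$), is finite for at least one stream $k$, then $\mathbb E_\infty(T_A)=O(A)$ as $A\to\infty$: there is a finite constant $C$ with $\mathbb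 E_\infty(T_A)\le C A$ for all sufficiently large $A$. -/

import Mathlib

open MeasureTheory ProbabilityTheory Filter InformationTheory
open scoped ENNReal NNReal

namespace TSSRP

/-- `g` is a probability density with respect to the reference measure `m`. -/
structure IsDensity {𝒳 : Type*} [MeasurableSpace 𝒳] (m : Measure 𝒳) (g : 𝒳 → ℝ) : Prop where
  measurable : Measurable g
  nonneg : ∀ x, 0 ≤ g x
  lintegral_eq_one : ∫⁻ x, ENNReal.ofReal (g x) ∂m = 1

/-- The probability measure with density `g` with respect to `m`. -/
noncomputable def law {𝒳 : Type*} [MeasurableSpace 𝒳] (m : Measure 𝒳) (g : 𝒳 → ℝ) : Measure 𝒳 :=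
  m.withDensity fun x => ENNReal.ofReal (g x)

/-- The local statistic `R_{k,t}` for the likelihood ratios `lr k`, the observations `X k t`
and the sensor layouts `S t` (only the times `t ≥ 1` of `X` and `S` are used). -/
noncomputable def R {K : ℕ} {𝒳 Ω : Type*} (lr : Fin K → 𝒳 → ℝ) (X : Fin K → ℕ → Ω → 𝒳)
    (S : ℕ → Ω → Finset (Fin K)) (k : Fin K) : ℕ → Ω → ℝ
  | 0, _ => 0
  | t + 1, ω =>
    if k ∈ S (t + 1) ω then (R lr X S k t ω + 1) * lr k (X k (t + 1) ω)
    else R lr X S k t ω + 1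

/-- The local likelihood ratio statistic `L_{k,t}`. -/
noncomputable def L {K : ℕ} {𝒳 Ω : Type*} (lr : Fin K → 𝒳 → ℝ) (X : Fin K → ℕ → Ω → 𝒳)
    (S : ℕ → Ω → Finset (Fin K)) (k : Fin K) : ℕ → Ω → ℝ
  | 0, _ => 1
  | t + 1, ω =>
    if k ∈ S (t + 1) ω then L lr X S k t ω * lr k (X k (t + 1) ω)
    else L lr X S k t ω

/-- The sampling statistic `R*_{k,t} = R_{k,t} + L_{k,t} R̃_{k,t}`, with `R̃ = Z`. -/
noncomputable def Rstar {K : ℕ} {𝒳 Ω : Type*} (lr : Fin K → 𝒳 → ℝ) (X : Fin K → ℕ → Ω → 𝒳)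
    (Z : Fin K → ℕ → Ω → ℝ) (S : ℕ → Ω → Finset (Fin K)) (k : Fin K) (t : ℕ) (ω : Ω) : ℝ :=
  R lr X S k t ω + L lr X S k t ω * Z k t ω

/-- The decreasing rearrangement of `v`: `orderStat v j` is the `(j+1)`-st largest entry. -/
noncomputable def orderStat {K : ℕ} (v : Fin K → ℝ) (j : Fin K) : ℝ :=
  v (Tuple.sort (fun i => -v i) j)

/-- The sum of the `r` largest entries of `v`. -/
noncomputable def topSum {K : ℕ} (r : ℕ) (v : Fin K → ℝ) : ℝ :=
  ∑ j : Fin K with j.val < r, orderStat v j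

/-- The stopping time `T = inf {t ≥ 1 : R_{(1),t} + ... + R_{(r),t} ≥ A}`, with `inf ∅ = ∞`. -/
noncomputable def T {K : ℕ} {𝒳 Ω : Type*} (lr : Fin K → 𝒳 → ℝ) (X : Fin K → ℕ → Ω → 𝒳)
    (S : ℕ → Ω → Finset (Fin K)) (r : ℕ) (A : ℝ) (ω : Ω) : ℕ∞ :=
  sInf ((fun t : ℕ => (t : ℕ∞)) '' {t | 1 ≤ t ∧ A ≤ topSum r fun k => R lr X S k t ω})

/-- The data and the random draws of the algorithm when no change ever occurs. At every time
`t + 1` the observations `X k (t + 1)`, with laws `μ k`, and the draws `Z k (t + 1)` from the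
priors `G k` are mutually independent and jointly independent of the past `ℱ t`. -/
structure IsInControl {K : ℕ} {𝒳 Ω : Type*} [MeasurableSpace 𝒳] {mΩ : MeasurableSpace Ω}
    (P : Measure Ω) (ℱ : Filtration ℕ mΩ) (μ : Fin K → Measure 𝒳) (G : Fin K → Measure ℝ)
    (X : Fin K → ℕ → Ω → 𝒳) (Z : Fin K → ℕ → Ω → ℝ) : Prop where
  measurable_obs : ∀ k t, Measurable[ℱ (t + 1)] (X k (t + 1))
  measurable_draw : ∀ k t, Measurable[ℱ (t + 1)] (Z k (t + 1))
  law_obs : ∀ k t, P.map (X k (t + 1)) = μ k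
  law_draw : ∀ k t, P.map (Z k (t + 1)) = G k
  indep_obs : ∀ t, iIndepFun (fun k => X k (t + 1)) P
  indep_draw : ∀ t, iIndepFun (fun k => Z k (t + 1)) P
  indep_obs_draw : ∀ t, IndepFun (fun ω k => X k (t + 1) ω) (fun ω k => Z k (t + 1) ω) P
  indep_past : ∀ t, Indep
    (MeasurableSpace.comap (fun ω => ((fun k => X k (t + 1) ω), (fun k => Z k (t + 1) ω)))
      inferInstance) (ℱ t) P

/-- `S` is a sequence of sensor layouts produced by the sampling policy: `q` streams are
observed at each time, the layout of time `t + 1` is chosen from the information `ℱ t`, the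
first layout is an arbitrary random one, and from then on the layout of time `t + 1` consists
of `q` streams with the largest values of `R*_{k,t}`; ties may be broken in any way, possibly
at random, that does not anticipate the future. -/
structure IsLayout {K : ℕ} {𝒳 Ω : Type*} {mΩ : MeasurableSpace Ω}
    (ℱ : Filtration ℕ mΩ) (q : ℕ) (lr : Fin K → 𝒳 → ℝ) (X : Fin K → ℕ → Ω → 𝒳)
    (Z : Fin K → ℕ → Ω → ℝ) (S : ℕ → Ω → Finset (Fin K)) : Prop where
  card_eq : ∀ t ω, (S (t + 1) ω).card = q
  predictable : ∀ t k, MeasurableSet[ℱ t] {ω | k ∈ S (t + 1) ω}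
  largest : ∀ t, 1 ≤ t → ∀ ω, ∀ i ∈ S (t + 1) ω, ∀ j ∉ S (t + 1) ω,
    Rstar lr X Z S j t ω ≤ Rstar lr X Z S i t ω

end TSSRP

/-! Both bounds are drift estimates up to the first passage time, whose expectation is the sum over
`t ≥ 0` of the probabilities that level `A` has not been reached by time `t`.

For (i), a likelihood ratio has pre-change mean at most one, so each `R_k` gains at most one per
step on average, whether or not its stream is observed. The sum of all `R_k` thus has drift at most
`K`. It dominates the top-`r` sum, so it reaches `A` no later than `T`, and stopping it there gives
expected time at least `A / K` (`ofReal_le_mul_tsum_below`).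

For (ii), fix a stream with finite divergence. The top-`r` sum dominates its `R_k`, so it suffices
to bound the passage time of this one chain. The drift of `R_k` itself does not suffice, because its
overshoot over `A` is uncontrolled. It is replaced by a potential bounded by a multiple of `A` that
still gains at least 1/2 per step below `A`, whichever of the two moves the layout selects; the
expected time is then at most twice the bound (`tsum_below_le_two_mul`).

The potential is `V y = y * φ (log (y / B))`. The factor `y` turns the pre-change mean of `V (y *
l)` into `y` times the post-change mean of `φ (log (y / B) + log l)`. Under the post-change law `log
l` has mean equal to the divergence, which is positive unless the two laws agree. Everything
therefore rests on `exists_weight`: for a walk with positive drift there is a weight that vanishes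
far to the right, so that `V` is bounded, yet does not decrease on average from a nonpositive level.
-/

namespace TSSRP

/-! ### Bounded potentials for a single stream. -/

section Potential

variable {𝒳 : Type*} [MeasurableSpace 𝒳]

theorem exists_integral_posPart_sub_le (μ : Measure 𝒳) {ξ : 𝒳 → ℝ}
    (hξ : Integrable ξ μ) {ε : ℝ} (hε : 0 < ε) :
    ∃ c : ℝ, 0 ≤ c ∧ ∫ x, max (ξ x - c) 0 ∂μ ≤ ε := by
  have h : Tendsto (fun n : ℕ => ∫ x, max (ξ x - n) 0 ∂μ) atTop (nhds (∫ _, (0 : ℝ) ∂μ)) := by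
    have hb : ∀ (n : ℕ) x, ‖max (ξ x - n) 0‖ ≤ |ξ x| := by
      intro n x
      have hn : (0 : ℝ) ≤ n := n.cast_nonneg
      rw [Real.norm_of_nonneg (le_max_right _ _)]
      exact max_le (by linarith [le_abs_self (ξ x)]) (abs_nonneg _)
    refine tendsto_integral_of_dominated_convergence (fun x => |ξ x|) (fun n => ?_) hξ.abs
      (fun n => Eventually.of_forall (hb n)) (Eventually.of_forall fun x => ?_)
    · exact (hξ.aestronglyMeasurable.sub aestronglyMeasurable_const).sup
        aestronglyMeasurable_const
    · obtain ⟨N, hN⟩ := exists_nat_ge (ξ x)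
      refine tendsto_const_nhds.congr' ?_
      filter_upwards [eventually_ge_atTop N] with n hn
      have : (N : ℝ) ≤ n := by exact_mod_cast hn
      rw [max_eq_right]
      linarith
  rw [integral_zero] at h
  obtain ⟨n, hn⟩ := (h.eventually (ge_mem_nhds hε)).exists
  exact ⟨n, n.cast_nonneg, hn⟩

/-- A bounded weight, bounded below on the negative half-line, whose expectation does not decrease
under a step of a random walk with positive drift started at a nonpositive level. -/
theorem exists_weight (μ : Measure 𝒳) [IsProbabilityMeasure μ] {ξ : 𝒳 → ℝ} (hm : Measurable ξ)
    (hξ : Integrable ξ μ) (hpos : 0 < ∫ x, ξ x ∂μ) :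
    ∃ (c : ℝ) (φ : ℝ → ℝ), Measurable φ ∧ (∀ s, 0 ≤ φ s) ∧ (∀ s, φ s ≤ 1) ∧
      (∀ s, c < s → φ s = 0) ∧ (∀ s ≤ 0, 1 / 2 ≤ φ s) ∧ MonotoneOn φ (Set.Iic 0) ∧
      ∀ s ≤ 0, φ s ≤ ∫ x, φ (s + ξ x) ∂μ := by
  -- Truncating the steps at `b` keeps at least half of the drift.
  obtain ⟨b, hb0, hb⟩ := exists_integral_posPart_sub_le μ hξ (half_pos hpos)
  have hint : ∀ a : ℝ, Integrable (fun x => max (ξ x + a) 0) μ := fun a =>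
    (hξ.add (integrable_const a)).sup (integrable_const 0)
  have hminint : Integrable (fun x => min (ξ x) b) μ := hξ.inf (integrable_const b)
  set I : ℝ := ∫ x, min (ξ x) b ∂μ with hI
  have hIpos : 0 < I := by
    have : I = ∫ x, ξ x ∂μ - ∫ x, max (ξ x - b) 0 ∂μ := by
      rw [hI, ← integral_sub hξ (by simpa [sub_eq_add_neg] using hint (-b))]
      congr with x
      rcases le_total (ξ x) b with h | h
      · rw [min_eq_left h, max_eq_right (by linarith)]; ring
      · rw [min_eq_right h, max_eq_left (by linarith)]; ring
    linarith
  -- With `c` chosen so, the function `ψ` below satisfies `ψ b ≤ 1/2 + I⁻¹ * (I / 2) = 1`.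
  obtain ⟨c, hc0, hc⟩ := exists_integral_posPart_sub_le μ hξ (half_pos hIpos)
  -- `ψ` is convex, with slope at `s` equal to `I⁻¹` times the probability of jumping from `s`
  -- beyond `b + c`. The weight is `ψ` frozen at `b` and killed beyond `b + c`; the factor `I⁻¹`
  -- makes the gain from the drift pay exactly for the killing.
  set ψ : ℝ → ℝ := fun s => 1 / 2 + I⁻¹ * ∫ x, max (ξ x + (s - (b + c))) 0 ∂μ with hψ
  have hψmono : Monotone ψ := by
    intro s t hst
    simp only [hψ]
    have : ∫ x, max (ξ x + (s - (b + c))) 0 ∂μ ≤ ∫ x, max (ξ x + (t - (b + c))) 0 ∂μ :=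
      integral_mono (hint _) (hint _) fun x => max_le_max (by linarith) le_rfl
    gcongr
  have hψhalf : ∀ s, 1 / 2 ≤ ψ s := by
    intro s
    have : 0 ≤ ∫ x, max (ξ x + (s - (b + c))) 0 ∂μ := integral_nonneg fun x => le_max_right _ _
    have := mul_nonneg (inv_nonneg.2 hIpos.le) this
    simp only [hψ]; linarith
  have hψone : ∀ s ≤ b, ψ s ≤ 1 := by
    intro s hs
    refine (hψmono hs).trans ?_
    have h1 : ∫ x, max (ξ x + (b - (b + c))) 0 ∂μ ≤ I / 2 := by
      refine le_trans (le_of_eq ?_) hc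
      congr with x
      congr 1
      ring
    have h2 := mul_le_mul_of_nonneg_left h1 (inv_nonneg.2 hIpos.le)
    have h3 : I⁻¹ * (I / 2) = 1 / 2 := by field_simp
    simp only [hψ]; linarith
  have hφm : Measurable fun s => if s ≤ b + c then ψ (min s b) else 0 :=
    Measurable.ite measurableSet_Iic (hψmono.measurable.comp (measurable_id.min measurable_const))
      measurable_const
  have hφ0 : ∀ s : ℝ, 0 ≤ if s ≤ b + c then ψ (min s b) else 0 := by
    intro s
    split_ifs
    · linarith [hψhalf (min s b)]
    · exact le_rfl
  have hφ1 : ∀ s : ℝ, (if s ≤ b + c then ψ (min s b) else 0) ≤ 1 := by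
    intro s
    split_ifs
    · exact hψone _ (min_le_right _ _)
    · exact zero_le_one
  have hφψ : ∀ s ≤ 0, (if s ≤ b + c then ψ (min s b) else 0) = ψ s := by
    intro s hs
    rw [if_pos (by linarith), min_eq_left (by linarith)]
  refine ⟨b + c, fun s => if s ≤ b + c then ψ (min s b) else 0, hφm, hφ0, hφ1,
    fun s hs => if_neg hs.not_ge, fun s hs => ?_, fun s hs t ht hst => ?_, fun s hs => ?_⟩
  · simp only [hφψ s hs]; exact hψhalf s
  · simp only [hφψ s hs, hφψ t ht]; exact hψmono hst
  simp only [hφψ s hs]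
  -- `E` is the event that the step leads to the killed region; `hsub` is the tangent line
  -- inequality for `ψ` at `s`.
  set E : Set 𝒳 := {x | 0 < ξ x + (s - (b + c))} with hE
  have hEm : MeasurableSet E := measurableSet_lt measurable_const (hm.add_const _)
  have hsub : ∀ h : ℝ, ψ s + h * (I⁻¹ * μ.real E) ≤ ψ (s + h) := by
    intro h
    have h1 : ∫ x, (max (ξ x + (s - (b + c))) 0 + E.indicator (fun _ => h) x) ∂μ
        ≤ ∫ x, max (ξ x + (s + h - (b + c))) 0 ∂μ := by
      refine integral_mono ((hint _).add ((integrable_const h).indicator hEm)) (hint _) fun x => ?_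
      by_cases hx : x ∈ E
      · have : 0 < ξ x + (s - (b + c)) := hx
        simp only [Set.indicator_of_mem hx]
        rw [max_eq_left this.le]
        exact le_trans (by linarith) (le_max_left _ _)
      · have : ξ x + (s - (b + c)) ≤ 0 := not_lt.1 hx
        simp only [Set.indicator_of_notMem hx]
        rw [max_eq_right this, add_zero]
        exact le_max_right _ _
    rw [integral_add (hint _) ((integrable_const h).indicator hEm), integral_indicator_const _ hEm,
      smul_eq_mul] at h1
    have h2 := mul_le_mul_of_nonneg_left h1 (inv_nonneg.2 hIpos.le)
    simp only [hψ]
    linarith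
  -- Apply the tangent line with `h = min (ξ x) b`. On `E` the weight drops to zero, at a cost of at
  -- most 1 since `ψ ≤ 1` up to `b`. In the mean, the linear term contributes `I * (I⁻¹ * μ.real E)
  -- = μ.real E`, which cancels that cost.
  have hle : ∀ x, ψ s + min (ξ x) b * (I⁻¹ * μ.real E) - E.indicator (fun _ => (1 : ℝ)) x ≤
      if s + ξ x ≤ b + c then ψ (min (s + ξ x) b) else 0 := by
    intro x
    have h1 := hsub (min (ξ x) b)
    by_cases hx : x ∈ E
    · have hx' : 0 < ξ x + (s - (b + c)) := hx
      rw [if_neg (by linarith), Set.indicator_of_mem hx]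
      have := hψone (s + min (ξ x) b) (by linarith [min_le_right (ξ x) b])
      linarith
    · have hx' : ξ x + (s - (b + c)) ≤ 0 := not_lt.1 hx
      rw [if_pos (by linarith), Set.indicator_of_notMem hx, sub_zero]
      refine h1.trans (hψmono (le_min ?_ ?_))
      · linarith [min_le_left (ξ x) b]
      · linarith [min_le_right (ξ x) b]
  have hi1 : Integrable (fun x => ψ s + min (ξ x) b * (I⁻¹ * μ.real E)) μ :=
    (integrable_const _).add (hminint.mul_const _)
  have hi2 : Integrable (E.indicator fun _ => (1 : ℝ)) μ := (integrable_const _).indicator hEm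
  have hi3 : Integrable (fun x => if s + ξ x ≤ b + c then ψ (min (s + ξ x) b) else 0) μ := by
    refine Integrable.of_bound (hφm.comp (hm.const_add s)).aestronglyMeasurable 1
      (Eventually.of_forall fun x => ?_)
    rw [Real.norm_of_nonneg (hφ0 _)]
    exact hφ1 _
  calc ψ s = ∫ x, (ψ s + min (ξ x) b * (I⁻¹ * μ.real E) - E.indicator (fun _ => (1 : ℝ)) x) ∂μ := by
        rw [integral_sub hi1 hi2, integral_add (integrable_const _) (hminint.mul_const _),
          integral_mul_const, ← hI, integral_indicator_const _ hEm]
        simp only [integral_const, probReal_univ, smul_eq_mul]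
        field_simp
        ring
    _ ≤ _ := integral_mono (hi1.sub hi2) hi3 hle

/-- A bounded potential for the one-stream chain that moves from `x` either to `x + 1` or to
`(x + 1) * l`, where `l` is the likelihood ratio of an observation with law `μ₀`. -/
structure IsPotential (μ₀ : Measure 𝒳) (l : 𝒳 → ℝ) (B : ℝ) (M : ℝ≥0∞) (V : ℝ → ℝ≥0∞) : Prop where
  measurable : Measurable V
  le_bound : ∀ x, V x ≤ M
  add_half_le : ∀ x, 0 ≤ x → x + 1 ≤ B → V x + 1 / 2 ≤ V (x + 1)
  le_lintegral : ∀ y, 0 < y → y ≤ B → V y ≤ ∫⁻ x, V (y * l x) ∂μ₀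

/-- With a trivial likelihood ratio an observation multiplies by one, so the chain only climbs by
unit steps and truncation at `B` suffices. -/
theorem isPotential_of_ae_eq_one (μ₀ : Measure 𝒳) [IsProbabilityMeasure μ₀] {l : 𝒳 → ℝ}
    (hl : ∀ᵐ x ∂μ₀, l x = 1) (B : ℝ) :
    IsPotential μ₀ l B (ENNReal.ofReal B) fun x => ENNReal.ofReal (min x B) where
  measurable := by fun_prop
  le_bound x := ENNReal.ofReal_le_ofReal (min_le_right _ _)
  add_half_le x hx hxB := by
    have h : (1 / 2 : ℝ≥0∞) = ENNReal.ofReal (1 / 2) := by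
      rw [ENNReal.ofReal_div_of_pos two_pos]; simp
    rw [min_eq_left hxB, min_eq_left (by linarith), h, ← ENNReal.ofReal_add hx (by norm_num)]
    exact ENNReal.ofReal_le_ofReal (by linarith)
  le_lintegral y hy hyB := by
    have : ∫⁻ x, ENNReal.ofReal (min (y * l x) B) ∂μ₀ = ∫⁻ _, ENNReal.ofReal (min y B) ∂μ₀ :=
      lintegral_congr_ae (hl.mono fun x hx => by simp only [hx, mul_one])
    rw [this]
    simp

/-- Change of measure: the factor `y` in `V y = y * φ (log (y / B))` absorbs the likelihood ratio,
leaving a step of the walk `log l` under `μ₁`. Since `φ` vanishes beyond `c`, `V` is at most `exp c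
* B`. -/
theorem exists_isPotential_of_integral_log_pos (μ₀ μ₁ : Measure 𝒳) [IsProbabilityMeasure μ₁]
    {l : 𝒳 → ℝ} (hl : Measurable l) (hl0 : ∀ x, 0 ≤ l x)
    (hμ : μ₁ = μ₀.withDensity fun x => ENNReal.ofReal (l x))
    (hint : Integrable (fun x => Real.log (l x)) μ₁) (hpos : 0 < ∫ x, Real.log (l x) ∂μ₁) :
    ∃ C : ℝ, 0 ≤ C ∧ ∀ B : ℝ, 0 < B → ∃ V, IsPotential μ₀ l B (ENNReal.ofReal (C * B)) V := by
  have hlogm : Measurable fun x => Real.log (l x) := hl.log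
  obtain ⟨c, φ, hφm, hφ0, hφ1, hφc, hφhalf, hφmono, hφint⟩ := exists_weight μ₁ hlogm hint hpos
  refine ⟨Real.exp c, (Real.exp_pos c).le, fun B hB =>
    ⟨fun y => ENNReal.ofReal (y * φ (Real.log (y / B))), ?_, fun y => ?_, fun x hx hxB => ?_,
      fun y hy hyB => ?_⟩⟩
  · exact (measurable_id.mul (hφm.comp (measurable_id.div_const B).log)).ennreal_ofReal
  · refine ENNReal.ofReal_le_ofReal ?_
    rcases le_or_gt y 0 with hy | hy
    · exact (mul_nonpos_of_nonpos_of_nonneg hy (hφ0 _)).trans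
        (mul_pos (Real.exp_pos c) hB).le
    rcases le_or_gt (Real.log (y / B)) c with h | h
    · rw [Real.log_le_iff_le_exp (div_pos hy hB), div_le_iff₀ hB] at h
      exact (mul_le_of_le_one_right hy.le (hφ1 _)).trans h
    · rw [hφc _ h, mul_zero]
      exact (mul_pos (Real.exp_pos c) hB).le
  · have h : (1 / 2 : ℝ≥0∞) = ENNReal.ofReal (1 / 2) := by
      rw [ENNReal.ofReal_div_of_pos two_pos]; simp
    rw [h, ← ENNReal.ofReal_add (mul_nonneg hx (hφ0 _)) (by norm_num)]
    refine ENNReal.ofReal_le_ofReal ?_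
    have h1 : Real.log ((x + 1) / B) ≤ 0 :=
      Real.log_nonpos (by positivity) ((div_le_one hB).2 hxB)
    have h2 := hφhalf _ h1
    -- At `x = 0` the convention `log 0 = 0` would break monotonicity of the logarithm, but there
    -- `V` vanishes. For `x > 0`, monotonicity of `φ` leaves a gain of at least `φ (log ((x + 1) /
    -- B)) ≥ 1/2`.
    rcases hx.eq_or_lt with rfl | hx
    · linarith
    have h3 : Real.log (x / B) ≤ Real.log ((x + 1) / B) := by
      apply Real.log_le_log (by positivity)
      gcongr
      linarith
    have h4 := mul_le_mul_of_nonneg_left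
      (hφmono (Set.mem_Iic.2 (h3.trans h1)) (Set.mem_Iic.2 h1) h3) hx.le
    linarith
  · have hs : Real.log (y / B) ≤ 0 :=
      Real.log_nonpos (by positivity) ((div_le_one hB).2 hyB)
    have hlpos : ∀ᵐ x ∂μ₁, 0 < l x := by
      rw [hμ, ae_withDensity_iff hl.ennreal_ofReal]
      exact Eventually.of_forall fun x hx => ENNReal.ofReal_pos.1 (pos_iff_ne_zero.2 hx)
    have hφs : Integrable (fun x => φ (Real.log (y / B) + Real.log (l x))) μ₁ := by
      refine Integrable.of_bound (hφm.comp (hlogm.const_add _)).aestronglyMeasurable 1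
        (Eventually.of_forall fun x => ?_)
      rw [Real.norm_of_nonneg (hφ0 _)]
      exact hφ1 _
    calc ENNReal.ofReal (y * φ (Real.log (y / B)))
        ≤ ENNReal.ofReal (y * ∫ x, φ (Real.log (y / B) + Real.log (l x)) ∂μ₁) :=
          ENNReal.ofReal_le_ofReal (mul_le_mul_of_nonneg_left (hφint _ hs) hy.le)
      _ = ENNReal.ofReal y *
            ∫⁻ x, ENNReal.ofReal (φ (Real.log (y / B) + Real.log (l x))) ∂μ₁ := by
          rw [ENNReal.ofReal_mul hy.le,
            ofReal_integral_eq_lintegral_ofReal hφs (Eventually.of_forall fun x => hφ0 _)]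
      _ = ENNReal.ofReal y * ∫⁻ x, ENNReal.ofReal (φ (Real.log (y * l x / B))) ∂μ₁ := by
          congr 1
          refine lintegral_congr_ae (hlpos.mono fun x hx => ?_)
          simp only
          rw [← Real.log_mul (by positivity) hx.ne', div_mul_eq_mul_div]
      _ = ∫⁻ x, ENNReal.ofReal (y * l x * φ (Real.log (y * l x / B))) ∂μ₀ := by
          have hm : Measurable fun x => ENNReal.ofReal (φ (Real.log (y * l x / B))) :=
            (hφm.comp ((hl.const_mul y).div_const B).log).ennreal_ofReal
          rw [hμ, lintegral_withDensity_eq_lintegral_mul _ hl.ennreal_ofReal hm,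
            ← lintegral_const_mul _ (hl.ennreal_ofReal.mul hm)]
          refine lintegral_congr fun x => ?_
          rw [Pi.mul_apply, mul_assoc, ENNReal.ofReal_mul hy.le, ENNReal.ofReal_mul (hl0 x)]

end Potential

/-! ### Likelihood ratios of densities and their divergence. -/

section Density

variable {𝒳 : Type*} [MeasurableSpace 𝒳] {m : Measure 𝒳} {g₀ g₁ : 𝒳 → ℝ}

theorem IsDensity.isProbabilityMeasure_law (h : IsDensity m g₀) :
    IsProbabilityMeasure (law m g₀) :=
  ⟨by rw [law, withDensity_apply _ MeasurableSet.univ, Measure.restrict_univ, h.lintegral_eq_one]⟩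

/-- Only an inequality: the mass of `g₁` on `{g₀ = 0}` is lost, since division by zero gives zero.
-/
theorem lintegral_ratio_le_one (h₀ : IsDensity m g₀) (h₁ : IsDensity m g₁) :
    ∫⁻ x, ENNReal.ofReal (g₁ x / g₀ x) ∂law m g₀ ≤ 1 := by
  have hlm : Measurable fun x => g₁ x / g₀ x := h₁.measurable.div h₀.measurable
  rw [law, lintegral_withDensity_eq_lintegral_mul _ h₀.measurable.ennreal_ofReal
    hlm.ennreal_ofReal, ← h₁.lintegral_eq_one]
  refine lintegral_mono fun x => ?_
  rw [Pi.mul_apply, ← ENNReal.ofReal_mul (h₀.nonneg x)]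
  refine ENNReal.ofReal_le_ofReal ?_
  rcases (h₀.nonneg x).eq_or_lt with h | h
  · rw [← h, zero_mul]; exact h₁.nonneg x
  · rw [mul_div_cancel₀ _ h.ne']

/-- Absolute continuity makes `g₁` vanish almost everywhere on `{g₀ = 0}`, so the convention for
division by zero loses no mass. -/
theorem law_eq_withDensity_ratio (h₀ : IsDensity m g₀) (h₁ : IsDensity m g₁)
    (hac : law m g₁ ≪ law m g₀) :
    law m g₁ = (law m g₀).withDensity fun x => ENNReal.ofReal (g₁ x / g₀ x) := by
  have hlm : Measurable fun x => g₁ x / g₀ x := h₁.measurable.div h₀.measurable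
  have hm₀ := h₀.measurable.ennreal_ofReal
  have hm₁ := h₁.measurable.ennreal_ofReal
  have hz : ∀ᵐ x ∂m, g₀ x = 0 → g₁ x = 0 := by
    have h1 : ∀ᵐ x ∂law m g₀, g₀ x ≠ 0 := by
      rw [law, ae_withDensity_iff hm₀]
      exact Eventually.of_forall fun x hx h => hx (by rw [h, ENNReal.ofReal_zero])
    have h2 : ∀ᵐ x ∂law m g₁, g₀ x ≠ 0 := hac.ae_le h1
    rw [law, ae_withDensity_iff hm₁] at h2
    filter_upwards [h2] with x hx h0
    by_contra hne
    exact hx (ENNReal.ofReal_pos.2 ((h₁.nonneg x).lt_of_ne' hne)).ne' h0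
  rw [law, law, ← withDensity_mul _ hm₀ hlm.ennreal_ofReal]
  refine withDensity_congr_ae (hz.mono fun x hx => ?_)
  simp only [Pi.mul_apply]
  rw [← ENNReal.ofReal_mul (h₀.nonneg x)]
  by_cases h : g₀ x = 0
  · rw [hx h, h, zero_mul]
  · rw [mul_div_cancel₀ _ h]

/-- If the laws agree, the ratio is almost surely one. Otherwise the divergence is strictly
positive, and it is the post-change mean of the log-likelihood ratio. -/
theorem exists_isPotential (h₀ : IsDensity m g₀) (h₁ : IsDensity m g₁)
    (hkl : klDiv (law m g₁) (law m g₀) ≠ ∞) :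
    ∃ C : ℝ, 0 ≤ C ∧ ∀ B : ℝ, 0 < B →
      ∃ V, IsPotential (law m g₀) (fun x => g₁ x / g₀ x) B (ENNReal.ofReal (C * B)) V := by
  have := h₀.isProbabilityMeasure_law
  have := h₁.isProbabilityMeasure_law
  obtain ⟨hac, hint⟩ := klDiv_ne_top_iff.1 hkl
  have hlm : Measurable fun x => g₁ x / g₀ x := h₁.measurable.div h₀.measurable
  have hl0 : ∀ x, 0 ≤ g₁ x / g₀ x := fun x => div_nonneg (h₁.nonneg x) (h₀.nonneg x)
  have hd := law_eq_withDensity_ratio h₀ h₁ hac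
  have hrn : (law m g₁).rnDeriv (law m g₀) =ᵐ[law m g₀] fun x => ENNReal.ofReal (g₁ x / g₀ x) := by
    conv_lhs => rw [hd]
    exact Measure.rnDeriv_withDensity _ hlm.ennreal_ofReal
  by_cases heq : law m g₁ = law m g₀
  · refine ⟨1, zero_le_one, fun B _ => ⟨fun x => ENNReal.ofReal (min x B), ?_⟩⟩
    rw [one_mul]
    refine isPotential_of_ae_eq_one _ ?_ B
    rw [heq] at hrn
    filter_upwards [hrn, Measure.rnDeriv_self (law m g₀)] with x hx hx'
    rw [hx', eq_comm, ENNReal.ofReal_eq_one] at hx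
    exact hx
  · have hllr : llr (law m g₁) (law m g₀) =ᵐ[law m g₁] fun x => Real.log (g₁ x / g₀ x) := by
      filter_upwards [hac.ae_le hrn] with x hx
      rw [llr, hx, ENNReal.toReal_ofReal (hl0 x)]
    refine exists_isPotential_of_integral_log_pos _ (law m g₁) hlm hl0 hd (hint.congr hllr) ?_
    rw [← integral_congr_ae hllr, ← toReal_klDiv_of_measure_eq hac (by simp)]
    exact ENNReal.toReal_pos (fun h => heq (klDiv_eq_zero_iff.1 h)) hkl

end Density

end TSSRP

namespace TSSRP

/-! ### Comparison of the top-`r` sum with one entry and with the full sum. -/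

section Order

variable {K : ℕ}

theorem orderStat_nonneg {v : Fin K → ℝ} (hv : ∀ k, 0 ≤ v k) (j : Fin K) : 0 ≤ orderStat v j :=
  hv _

theorem le_topSum {r : ℕ} (hr : 1 ≤ r) {v : Fin K → ℝ} (hv : ∀ k, 0 ≤ v k) (k : Fin K) :
    v k ≤ topSum r v := by
  have hK : 0 < K := k.pos
  have h0 : v k ≤ orderStat v ⟨0, hK⟩ := by
    have h := Tuple.monotone_sort (fun i => -v i)
      (show (⟨0, hK⟩ : Fin K) ≤ (Tuple.sort fun i => -v i).symm k from Nat.zero_le _)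
    simpa [orderStat] using h
  refine h0.trans ?_
  exact Finset.single_le_sum (f := orderStat v) (fun j _ => orderStat_nonneg hv j)
    (Finset.mem_filter.2 ⟨Finset.mem_univ _, hr⟩)

theorem topSum_le_sum (r : ℕ) {v : Fin K → ℝ} (hv : ∀ k, 0 ≤ v k) : topSum r v ≤ ∑ k, v k := by
  calc topSum r v ≤ ∑ j, orderStat v j :=
        Finset.sum_le_sum_of_subset_of_nonneg (Finset.filter_subset _ _)
          fun j _ _ => orderStat_nonneg hv j
    _ = ∑ k, v k := Equiv.sum_comp (Tuple.sort fun i => -v i) v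

end Order

/-! ### Expected passage times from drift conditions. -/

section HittingTime

variable {Ω : Type*}

/-- The event that the process `Y` stays below the level `A` at the times `1, …, t`. -/
def below (Y : ℕ → Ω → ℝ) (A : ℝ) (t : ℕ) : Set Ω :=
  {ω | ∀ s, 1 ≤ s → s ≤ t → Y s ω < A}

theorem below_succ (Y : ℕ → Ω → ℝ) (A : ℝ) (t : ℕ) :
    below Y A (t + 1) = below Y A t ∩ {ω | Y (t + 1) ω < A} := by
  ext ω
  constructor
  · exact fun h => ⟨fun s h1 h2 => h s h1 (by omega), h _ (by omega) le_rfl⟩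
  · rintro ⟨h, h'⟩ s h1 h2
    rcases Nat.le_succ_iff.1 h2 with h2 | rfl
    · exact h s h1 h2
    · exact h'

theorem compl_below_succ (Y : ℕ → Ω → ℝ) (A : ℝ) (t : ℕ) :
    (below Y A (t + 1))ᶜ = (below Y A t)ᶜ ∪ (below Y A t \ {ω | Y (t + 1) ω < A}) := by
  rw [below_succ]
  ext ω
  simp only [Set.mem_compl_iff, Set.mem_inter_iff, Set.mem_union, Set.mem_sdiff]
  tauto

theorem measurableSet_below {mΩ : MeasurableSpace Ω} {ℱ : Filtration ℕ mΩ} {Y : ℕ → Ω → ℝ}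
    (hY : ∀ t, Measurable[ℱ t] (Y t)) (A : ℝ) (t : ℕ) : MeasurableSet[ℱ t] (below Y A t) := by
  induction t with
  | zero =>
    have : below Y A 0 = Set.univ := Set.eq_univ_of_forall fun ω s h1 h2 => by omega
    rw [this]
    exact MeasurableSet.univ
  | succ t ih =>
    rw [below_succ]
    exact (ℱ.mono t.le_succ _ ih).inter (hY (t + 1) measurableSet_Iio)

/-- The sum counts the times `t ≥ 0` before `Y` first reaches `A` at a positive time. The predicate
`p` stands for the stopping rule of another process, so that this lemma and the next also carry the
comparison between the two processes. -/
theorem tsum_below_le_hittingTime {Y : ℕ → Ω → ℝ} {A : ℝ} {p : ℕ → Prop} {ω : Ω}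
    (h : ∀ t, p t → A ≤ Y t ω) :
    ∑' t, (below Y A t).indicator (1 : Ω → ℝ≥0∞) ω ≤
      (sInf ((fun t : ℕ => (t : ℕ∞)) '' {t | 1 ≤ t ∧ p t}) : ℕ∞) := by
  rcases Set.eq_empty_or_nonempty ((fun t : ℕ => (t : ℕ∞)) '' {t | 1 ≤ t ∧ p t}) with he | hne
  · rw [he, sInf_empty]
    exact le_top
  obtain ⟨n, ⟨hn1, hpn⟩, hn⟩ := csInf_mem hne
  rw [← hn]
  have hz : ∀ t ∉ Finset.range n, (below Y A t).indicator (1 : Ω → ℝ≥0∞) ω = 0 := by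
    intro t ht
    rw [Finset.mem_range, not_lt] at ht
    have hmem : ω ∉ below Y A t := fun hb => (h n hpn).not_gt (hb n hn1 ht)
    exact Set.indicator_of_notMem hmem _
  rw [tsum_eq_sum hz]
  calc ∑ t ∈ Finset.range n, (below Y A t).indicator (1 : Ω → ℝ≥0∞) ω
      ≤ ∑ t ∈ Finset.range n, 1 := Finset.sum_le_sum fun t _ => Set.indicator_le_self' (by simp) ω
    _ = _ := by simp

theorem hittingTime_le_tsum_below {Y : ℕ → Ω → ℝ} {A : ℝ} {p : ℕ → Prop} {ω : Ω}
    (h : ∀ t, A ≤ Y t ω → p t) :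
    ((sInf ((fun t : ℕ => (t : ℕ∞)) '' {t | 1 ≤ t ∧ p t}) : ℕ∞) : ℝ≥0∞) ≤
      ∑' t, (below Y A t).indicator (1 : Ω → ℝ≥0∞) ω := by
  by_cases hex : ∃ n, 1 ≤ n ∧ A ≤ Y n ω
  · classical
    obtain ⟨h1, h2⟩ := Nat.find_spec hex
    set n := Nat.find hex
    have hle : sInf ((fun t : ℕ => (t : ℕ∞)) '' {t | 1 ≤ t ∧ p t}) ≤ (n : ℕ∞) :=
      sInf_le ⟨n, ⟨h1, h n h2⟩, rfl⟩
    calc ((sInf ((fun t : ℕ => (t : ℕ∞)) '' {t | 1 ≤ t ∧ p t}) : ℕ∞) : ℝ≥0∞)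
        ≤ ((n : ℕ∞) : ℝ≥0∞) := ENat.toENNReal_le.2 hle
      _ = ∑ t ∈ Finset.range n, (1 : ℝ≥0∞) := by simp
      _ = ∑ t ∈ Finset.range n, (below Y A t).indicator (1 : Ω → ℝ≥0∞) ω := by
          refine Finset.sum_congr rfl fun t ht => ?_
          have hmem : ω ∈ below Y A t := fun s hs1 hs2 => not_le.1 fun hA =>
            Nat.find_min hex (hs2.trans_lt (Finset.mem_range.1 ht)) ⟨hs1, hA⟩
          rw [Set.indicator_of_mem hmem, Pi.one_apply]
      _ ≤ _ := ENNReal.sum_le_tsum _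
  · have hmem : ∀ t, ω ∈ below Y A t := fun t s h1 _ => not_le.1 fun hA => hex ⟨s, h1, hA⟩
    have hall : ∀ t, (below Y A t).indicator (1 : Ω → ℝ≥0∞) ω = 1 := fun t =>
      Set.indicator_of_mem (hmem t) _
    simp only [hall, ENNReal.tsum_const_eq_top_of_ne_zero one_ne_zero]
    exact le_top

theorem lintegral_tsum_below {mΩ : MeasurableSpace Ω} {ℱ : Filtration ℕ mΩ} (P : Measure Ω)
    {Y : ℕ → Ω → ℝ} (hY : ∀ t, Measurable[ℱ t] (Y t)) (A : ℝ) :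
    ∫⁻ ω, ∑' t, (below Y A t).indicator (1 : Ω → ℝ≥0∞) ω ∂P = ∑' t, P (below Y A t) := by
  have hm : ∀ t, MeasurableSet (below Y A t) := fun t => ℱ.le t _ (measurableSet_below hY A t)
  rw [lintegral_tsum fun t => (measurable_one.indicator (hm t)).aemeasurable]
  exact tsum_congr fun t => lintegral_indicator_one (hm t)

/-- A nonnegative process with drift at most `c` takes an expected time at least `A / c` to
reach the level `A`. -/
theorem ofReal_le_mul_tsum_below {mΩ : MeasurableSpace Ω} {ℱ : Filtration ℕ mΩ} (P : Measure Ω)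
    [IsProbabilityMeasure P] {Y : ℕ → Ω → ℝ} (hY : ∀ t, Measurable[ℱ t] (Y t))
    (hY0 : ∀ ω, Y 0 ω = 0) {c : ℝ≥0∞} {A : ℝ} (hc : c ≠ 0)
    (hstep : ∀ t, ∫⁻ ω in below Y A t, ENNReal.ofReal (Y (t + 1) ω) ∂P ≤
      ∫⁻ ω in below Y A t, ENNReal.ofReal (Y t ω) ∂P + c * P (below Y A t)) :
    ENNReal.ofReal A ≤ c * ∑' t, P (below Y A t) := by
  have hm : ∀ t, MeasurableSet (below Y A t) := fun t => ℱ.le t _ (measurableSet_below hY A t)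
  have hmY : ∀ t, Measurable (Y t) := fun t => (hY t).mono (ℱ.le t) le_rfl
  -- Optional stopping at time `n`, with the stopped value replaced by its lower bound `A` once the
  -- level has been reached.
  have key : ∀ n, ∫⁻ ω in below Y A n, ENNReal.ofReal (Y n ω) ∂P
      + ENNReal.ofReal A * P (below Y A n)ᶜ ≤ c * ∑ t ∈ Finset.range n, P (below Y A t) := by
    intro n
    induction n with
    | zero =>
      have : below Y A 0 = Set.univ := Set.eq_univ_of_forall fun ω s h1 h2 => by omega
      simp [this, hY0]
    | succ n ih =>
      have hset : MeasurableSet {ω | Y (n + 1) ω < A} := hmY (n + 1) measurableSet_Iio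
      have h1 : ENNReal.ofReal A * P (below Y A n \ {ω | Y (n + 1) ω < A}) ≤
          ∫⁻ ω in below Y A n \ {ω | Y (n + 1) ω < A}, ENNReal.ofReal (Y (n + 1) ω) ∂P := by
        rw [← setLIntegral_const]
        exact setLIntegral_mono' ((hm n).diff hset) fun ω hω =>
          ENNReal.ofReal_le_ofReal (not_lt.1 hω.2)
      have h2 := lintegral_inter_add_sdiff (μ := P)
        (fun ω => ENNReal.ofReal (Y (n + 1) ω)) (below Y A n) hset
      calc ∫⁻ ω in below Y A (n + 1), ENNReal.ofReal (Y (n + 1) ω) ∂P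
            + ENNReal.ofReal A * P (below Y A (n + 1))ᶜ
          ≤ ∫⁻ ω in below Y A n ∩ {ω | Y (n + 1) ω < A}, ENNReal.ofReal (Y (n + 1) ω) ∂P
            + (ENNReal.ofReal A * P (below Y A n)ᶜ
              + ENNReal.ofReal A * P (below Y A n \ {ω | Y (n + 1) ω < A})) := by
            rw [compl_below_succ, below_succ, ← mul_add]
            gcongr
            exact measure_union_le _ _
        _ ≤ ∫⁻ ω in below Y A n ∩ {ω | Y (n + 1) ω < A}, ENNReal.ofReal (Y (n + 1) ω) ∂P
            + (ENNReal.ofReal A * P (below Y A n)ᶜ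
              + ∫⁻ ω in below Y A n \ {ω | Y (n + 1) ω < A}, ENNReal.ofReal (Y (n + 1) ω) ∂P) := by
            gcongr
        _ = ∫⁻ ω in below Y A n, ENNReal.ofReal (Y (n + 1) ω) ∂P
            + ENNReal.ofReal A * P (below Y A n)ᶜ := by
            rw [← h2]; ring
        _ ≤ ∫⁻ ω in below Y A n, ENNReal.ofReal (Y n ω) ∂P + c * P (below Y A n)
            + ENNReal.ofReal A * P (below Y A n)ᶜ := by gcongr; exact hstep n
        _ = (∫⁻ ω in below Y A n, ENNReal.ofReal (Y n ω) ∂P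
            + ENNReal.ofReal A * P (below Y A n)ᶜ) + c * P (below Y A n) := by ring
        _ ≤ c * ∑ t ∈ Finset.range (n + 1), P (below Y A t) := by
            rw [Finset.sum_range_succ, mul_add]; gcongr
  -- If the expected time is finite, the probability of not having stopped tends to zero, so letting
  -- `n` grow recovers all of `A`.
  by_cases hτ : ∑' t, P (below Y A t) = ∞
  · rw [hτ, ENNReal.mul_top hc]
    exact le_top
  have hlim : Tendsto (fun n => c * ∑' t, P (below Y A t) + ENNReal.ofReal A * P (below Y A n))
      atTop (nhds (c * ∑' t, P (below Y A t) + ENNReal.ofReal A * 0)) :=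
    tendsto_const_nhds.add (ENNReal.Tendsto.const_mul
      (ENNReal.tendsto_atTop_zero_of_tsum_ne_top hτ) (Or.inr ENNReal.ofReal_ne_top))
  rw [mul_zero, add_zero] at hlim
  refine ge_of_tendsto' hlim fun n => ?_
  calc ENNReal.ofReal A = ENNReal.ofReal A * (P (below Y A n)ᶜ + P (below Y A n)) := by
        rw [add_comm, measure_add_measure_compl (hm n), measure_univ, mul_one]
    _ ≤ c * ∑ t ∈ Finset.range n, P (below Y A t) + ENNReal.ofReal A * P (below Y A n) := by
        rw [mul_add]
        exact add_le_add_left (le_add_self.trans (key n)) _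
    _ ≤ _ := by gcongr; exact ENNReal.sum_le_tsum _

/-- If a potential bounded by `M` increases by at least `1 / 2` on average as long as the level
`A` has not been reached, then the level is reached after an expected time at most `2 * M`. -/
theorem tsum_below_le_two_mul {mΩ : MeasurableSpace Ω} {ℱ : Filtration ℕ mΩ} (P : Measure Ω)
    [IsProbabilityMeasure P] {Y : ℕ → Ω → ℝ} (hY : ∀ t, Measurable[ℱ t] (Y t)) {V : ℝ → ℝ≥0∞}
    {M : ℝ≥0∞} {A : ℝ} (hVM : ∀ x, V x ≤ M)
    (hstep : ∀ t, ∫⁻ ω in below Y A t, V (Y t ω) ∂P + 1 / 2 * P (below Y A t) ≤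
      ∫⁻ ω in below Y A t, V (Y (t + 1) ω) ∂P) :
    ∑' t, P (below Y A t) ≤ 2 * M := by
  have hm : ∀ t, MeasurableSet (below Y A t) := fun t => ℱ.le t _ (measurableSet_below hY A t)
  have hmY : ∀ t, Measurable (Y t) := fun t => (hY t).mono (ℱ.le t) le_rfl
  have hVset : ∀ (E : Set Ω) t, ∫⁻ ω in E, V (Y t ω) ∂P ≤ M * P E := fun E t => by
    rw [← setLIntegral_const]
    exact lintegral_mono fun ω => hVM _
  -- The potential at the passage time is replaced by its upper bound `M`, so the overshoot plays no
  -- role.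
  have key : ∀ n, 1 / 2 * ∑ t ∈ Finset.range n, P (below Y A t) ≤
      ∫⁻ ω in below Y A n, V (Y n ω) ∂P + M * P (below Y A n)ᶜ := by
    intro n
    induction n with
    | zero => simp
    | succ n ih =>
      have hset : MeasurableSet {ω | Y (n + 1) ω < A} := hmY (n + 1) measurableSet_Iio
      have hdisj : P (below Y A (n + 1))ᶜ =
          P (below Y A n)ᶜ + P (below Y A n \ {ω | Y (n + 1) ω < A}) := by
        rw [compl_below_succ, measure_union _ ((hm n).diff hset)]
        exact disjoint_compl_left.mono_right Set.sdiff_subset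
      calc 1 / 2 * ∑ t ∈ Finset.range (n + 1), P (below Y A t)
          = 1 / 2 * ∑ t ∈ Finset.range n, P (below Y A t) + 1 / 2 * P (below Y A n) := by
            rw [Finset.sum_range_succ, mul_add]
        _ ≤ ∫⁻ ω in below Y A n, V (Y n ω) ∂P + M * P (below Y A n)ᶜ
            + 1 / 2 * P (below Y A n) := by gcongr
        _ = (∫⁻ ω in below Y A n, V (Y n ω) ∂P + 1 / 2 * P (below Y A n))
            + M * P (below Y A n)ᶜ := by ring
        _ ≤ ∫⁻ ω in below Y A n, V (Y (n + 1) ω) ∂P + M * P (below Y A n)ᶜ := by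
            gcongr; exact hstep n
        _ = ∫⁻ ω in below Y A (n + 1), V (Y (n + 1) ω) ∂P
            + ∫⁻ ω in below Y A n \ {ω | Y (n + 1) ω < A}, V (Y (n + 1) ω) ∂P
            + M * P (below Y A n)ᶜ := by
            rw [below_succ, lintegral_inter_add_sdiff _ _ hset]
        _ ≤ ∫⁻ ω in below Y A (n + 1), V (Y (n + 1) ω) ∂P
            + M * P (below Y A n \ {ω | Y (n + 1) ω < A})
            + M * P (below Y A n)ᶜ := by gcongr; exact hVset _ _
        _ = _ := by rw [hdisj]; ring
  refine ENNReal.tsum_le_of_sum_range_le fun n => ?_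
  have h1 : 1 / 2 * ∑ t ∈ Finset.range n, P (below Y A t) ≤ M := by
    calc _ ≤ M * P (below Y A n) + M * P (below Y A n)ᶜ :=
          (key n).trans (add_le_add_left (hVset _ _) _)
      _ = M := by rw [← mul_add, measure_add_measure_compl (hm n), measure_univ, mul_one]
  calc ∑ t ∈ Finset.range n, P (below Y A t)
      = 2 * (1 / 2 * ∑ t ∈ Finset.range n, P (below Y A t)) := by
        rw [← mul_assoc, one_div, ENNReal.mul_inv_cancel two_ne_zero ENNReal.ofNat_ne_top, one_mul]
    _ ≤ 2 * M := by gcongr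

end HittingTime

/-! ### Integrating out an observation independent of the past. -/

section Indep

theorem setLIntegral_prod_of_indep {Ω 𝒳 : Type*} [MeasurableSpace 𝒳] {m' mΩ : MeasurableSpace Ω}
    (P : Measure Ω) [IsProbabilityMeasure P] (hm' : m' ≤ mΩ) {X : Ω → 𝒳} (hX : Measurable X)
    (hind : Indep (MeasurableSpace.comap X inferInstance) m' P) {Y : Ω → ℝ}
    (hY : Measurable[m'] Y) {E : Set Ω} (hE : MeasurableSet[m'] E) {g : ℝ × 𝒳 → ℝ≥0∞}
    (hg : Measurable g) :
    ∫⁻ ω in E, g (Y ω, X ω) ∂P = ∫⁻ ω in E, ∫⁻ x, g (Y ω, x) ∂P.map X ∂P := by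
  have : IsProbabilityMeasure (P.map X) := Measure.isProbabilityMeasure_map hX.aemeasurable
  -- Carrying the indicator of `E` along with `Y` reduces the integral over `E` to Fubini for the
  -- product law of `U` and `X`.
  set U : Ω → ℝ × ℝ≥0∞ := fun ω => (Y ω, E.indicator 1 ω) with hU
  have hUm' : Measurable[m'] U := hY.prodMk
    (Measurable.indicator (m := m') (f := fun _ => 1) measurable_const hE)
  have hUm : Measurable U := hUm'.mono hm' le_rfl
  have hEm : MeasurableSet E := hm' _ hE
  have hUX : IndepFun U X P := by
    rw [IndepFun_iff_Indep]
    exact indep_of_indep_of_le_left hind.symm hUm'.comap_le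
  have hmap := hUX.map_prod_eq_prod_map_map hUm.aemeasurable hX.aemeasurable
  have hG : Measurable fun z : (ℝ × ℝ≥0∞) × 𝒳 => z.1.2 * g (z.1.1, z.2) := by fun_prop
  have hind_mul : ∀ (F : Ω → ℝ≥0∞), ∫⁻ ω in E, F ω ∂P = ∫⁻ ω, E.indicator 1 ω * F ω ∂P := by
    intro F
    rw [← lintegral_indicator hEm]
    refine lintegral_congr fun ω => ?_
    by_cases h : ω ∈ E <;> simp [h]
  calc ∫⁻ ω in E, g (Y ω, X ω) ∂P
      = ∫⁻ z, z.1.2 * g (z.1.1, z.2) ∂P.map fun ω => (U ω, X ω) := by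
        rw [hind_mul, lintegral_map hG (hUm.prodMk hX)]
    _ = ∫⁻ u, ∫⁻ x, u.2 * g (u.1, x) ∂P.map X ∂P.map U := by
        rw [hmap, lintegral_prod _ hG.aemeasurable]
    _ = ∫⁻ ω, ∫⁻ x, (U ω).2 * g ((U ω).1, x) ∂P.map X ∂P :=
        lintegral_map hG.lintegral_prod_right' hUm
    _ = _ := by
        rw [hind_mul]
        refine lintegral_congr fun ω => ?_
        exact lintegral_const_mul _ (hg.comp measurable_prodMk_left)

end Indep

end TSSRP

namespace TSSRP

/-! ### One-step estimates for the streams and the two bounds on the stopping time. -/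

section Streams

variable {K : ℕ} {𝒳 Ω : Type*}

theorem R_nonneg {lr : Fin K → 𝒳 → ℝ} (hlr : ∀ k x, 0 ≤ lr k x) (X : Fin K → ℕ → Ω → 𝒳)
    (S : ℕ → Ω → Finset (Fin K)) (k : Fin K) (t : ℕ) (ω : Ω) : 0 ≤ R lr X S k t ω := by
  induction t with
  | zero => exact le_rfl
  | succ t ih =>
    rw [R]
    split_ifs
    · exact mul_nonneg (by linarith) (hlr _ _)
    · linarith

variable [MeasurableSpace 𝒳] {mΩ : MeasurableSpace Ω} {P : Measure Ω} {ℱ : Filtration ℕ mΩ}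
  {μ : Fin K → Measure 𝒳} {G : Fin K → Measure ℝ} {X : Fin K → ℕ → Ω → 𝒳}
  {Z : Fin K → ℕ → Ω → ℝ} {S : ℕ → Ω → Finset (Fin K)} {lr : Fin K → 𝒳 → ℝ} {q : ℕ}

theorem measurable_R (hlr : ∀ k, Measurable (lr k)) (hX : IsInControl P ℱ μ G X Z)
    (hS : IsLayout ℱ q lr X Z S) (k : Fin K) (t : ℕ) : Measurable[ℱ t] (R lr X S k t) := by
  induction t with
  | zero =>
    have : R lr X S k 0 = fun _ => 0 := rfl
    rw [this]
    exact measurable_const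
  | succ t ih =>
    have h1 : Measurable[ℱ (t + 1)] (R lr X S k t) := ih.mono (ℱ.mono t.le_succ) le_rfl
    have h2 : Measurable[ℱ (t + 1)] fun ω => lr k (X k (t + 1) ω) :=
      (hlr k).comp (hX.measurable_obs k t)
    exact Measurable.ite (ℱ.mono t.le_succ _ (hS.predictable t k))
      ((h1.add_const 1).mul h2) (h1.add_const 1)

theorem IsInControl.indep_obs_past (hX : IsInControl P ℱ μ G X Z) (k : Fin K) (t : ℕ) :
    Indep (MeasurableSpace.comap (X k (t + 1)) inferInstance) (ℱ t) P := by
  refine indep_of_indep_of_le_left (hX.indep_past t) ?_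
  have : X k (t + 1) = (fun p : (Fin K → 𝒳) × (Fin K → ℝ) => p.1 k) ∘
      fun ω => ((fun k => X k (t + 1) ω), (fun k => Z k (t + 1) ω)) := rfl
  rw [this, ← MeasurableSpace.comap_comp]
  exact MeasurableSpace.comap_mono ((measurable_pi_apply k).comp measurable_fst).comap_le

/-- One step of a stream, with the expectation over the new observation taken first. -/
theorem setLIntegral_R_succ [IsProbabilityMeasure P] (hlr : ∀ k, Measurable (lr k))
    (hX : IsInControl P ℱ μ G X Z) (hS : IsLayout ℱ q lr X Z S) (k : Fin K) (t : ℕ)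
    {W : ℝ → ℝ≥0∞} (hW : Measurable W) {E : Set Ω} (hE : MeasurableSet[ℱ t] E) :
    ∫⁻ ω in E, W (R lr X S k (t + 1) ω) ∂P =
      ∫⁻ ω in E ∩ {ω | k ∈ S (t + 1) ω}, ∫⁻ x, W ((R lr X S k t ω + 1) * lr k x) ∂μ k ∂P +
      ∫⁻ ω in E \ {ω | k ∈ S (t + 1) ω}, W (R lr X S k t ω + 1) ∂P := by
  have hobs := hS.predictable t k
  have hobs' : MeasurableSet {ω | k ∈ S (t + 1) ω} := ℱ.le t _ hobs
  have hEm : MeasurableSet E := ℱ.le t _ hE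
  rw [← lintegral_inter_add_sdiff _ E hobs']
  congr 1
  · have hg : Measurable fun z : ℝ × 𝒳 => W ((z.1 + 1) * lr k z.2) :=
      hW.comp ((measurable_fst.add_const 1).mul ((hlr k).comp measurable_snd))
    rw [← hX.law_obs k t, ← setLIntegral_prod_of_indep P (ℱ.le t)
      ((hX.measurable_obs k t).mono (ℱ.le _) le_rfl) (hX.indep_obs_past k t)
      (measurable_R hlr hX hS k t) (hE.inter hobs) hg]
    refine setLIntegral_congr_fun (hEm.inter hobs') fun ω hω => ?_
    have h : k ∈ S (t + 1) ω := hω.2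
    simp only [R, if_pos h]
  · refine setLIntegral_congr_fun (hEm.diff hobs') fun ω hω => ?_
    have h : k ∉ S (t + 1) ω := hω.2
    simp only [R, if_neg h]

/-- An unobserved stream gains exactly one; for an observed one, `R + 1` is multiplied by a factor
of mean at most one. -/
theorem setLIntegral_R_succ_le [IsProbabilityMeasure P] (hlr : ∀ k, Measurable (lr k))
    (hlr0 : ∀ k x, 0 ≤ lr k x) (hX : IsInControl P ℱ μ G X Z) (hS : IsLayout ℱ q lr X Z S)
    (k : Fin K) (hint : ∫⁻ x, ENNReal.ofReal (lr k x) ∂μ k ≤ 1) (t : ℕ) {E : Set Ω}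
    (hE : MeasurableSet[ℱ t] E) :
    ∫⁻ ω in E, ENNReal.ofReal (R lr X S k (t + 1) ω) ∂P ≤
      ∫⁻ ω in E, ENNReal.ofReal (R lr X S k t ω) ∂P + P E := by
  have hR0 := R_nonneg hlr0 X S k t
  have hEm : MeasurableSet E := ℱ.le t _ hE
  have hobs : MeasurableSet {ω | k ∈ S (t + 1) ω} := ℱ.le t _ (hS.predictable t k)
  rw [setLIntegral_R_succ hlr hX hS k t ENNReal.measurable_ofReal hE]
  calc _ ≤ ∫⁻ ω in E ∩ {ω | k ∈ S (t + 1) ω}, ENNReal.ofReal (R lr X S k t ω + 1) ∂P +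
        ∫⁻ ω in E \ {ω | k ∈ S (t + 1) ω}, ENNReal.ofReal (R lr X S k t ω + 1) ∂P := by
        gcongr with ω
        have h0 : 0 ≤ R lr X S k t ω + 1 := by linarith [hR0 ω]
        simp only [ENNReal.ofReal_mul h0]
        rw [lintegral_const_mul _ (hlr k).ennreal_ofReal]
        exact mul_le_of_le_one_right' hint
    _ = ∫⁻ ω in E, (ENNReal.ofReal (R lr X S k t ω) + 1) ∂P := by
        rw [lintegral_inter_add_sdiff _ _ hobs]
        refine lintegral_congr fun ω => ?_
        rw [ENNReal.ofReal_add (hR0 ω) zero_le_one, ENNReal.ofReal_one]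
    _ = _ := by
        rw [lintegral_add_right _ measurable_const, setLIntegral_one]

/-- Both moves first pass from `R` to `R + 1`, which gains 1/2; the likelihood factor of an observed
stream then loses nothing in the mean, provided `R + 1 ≤ B`. -/
theorem IsPotential.le_setLIntegral_R_succ [IsProbabilityMeasure P] (hlr : ∀ k, Measurable (lr k))
    (hlr0 : ∀ k x, 0 ≤ lr k x) (hX : IsInControl P ℱ μ G X Z) (hS : IsLayout ℱ q lr X Z S)
    {k : Fin K} {B : ℝ} {M : ℝ≥0∞} {V : ℝ → ℝ≥0∞} (hV : IsPotential (μ k) (lr k) B M V) (t : ℕ)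
    {E : Set Ω} (hE : MeasurableSet[ℱ t] E) (hEB : ∀ ω ∈ E, R lr X S k t ω + 1 ≤ B) :
    ∫⁻ ω in E, V (R lr X S k t ω) ∂P + 1 / 2 * P E ≤
      ∫⁻ ω in E, V (R lr X S k (t + 1) ω) ∂P := by
  have hR0 := R_nonneg hlr0 X S k t
  have hEm : MeasurableSet E := ℱ.le t _ hE
  have hobs : MeasurableSet {ω | k ∈ S (t + 1) ω} := ℱ.le t _ (hS.predictable t k)
  rw [setLIntegral_R_succ hlr hX hS k t hV.measurable hE]
  calc ∫⁻ ω in E, V (R lr X S k t ω) ∂P + 1 / 2 * P E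
      = ∫⁻ ω in E, (V (R lr X S k t ω) + 1 / 2) ∂P := by
        rw [lintegral_add_right _ measurable_const, setLIntegral_const]
    _ ≤ ∫⁻ ω in E, V (R lr X S k t ω + 1) ∂P :=
        setLIntegral_mono' hEm fun ω hω => hV.add_half_le _ (hR0 ω) (hEB ω hω)
    _ = ∫⁻ ω in E ∩ {ω | k ∈ S (t + 1) ω}, V (R lr X S k t ω + 1) ∂P +
        ∫⁻ ω in E \ {ω | k ∈ S (t + 1) ω}, V (R lr X S k t ω + 1) ∂P :=
        (lintegral_inter_add_sdiff _ _ hobs).symm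
    _ ≤ _ := by
        refine add_le_add_left (setLIntegral_mono' (hEm.inter hobs) fun ω hω => ?_) _
        exact hV.le_lintegral _ (by linarith [hR0 ω]) (hEB ω hω.1)

theorem ofReal_div_le_lintegral_T [IsProbabilityMeasure P] (hlr : ∀ k, Measurable (lr k))
    (hlr0 : ∀ k x, 0 ≤ lr k x) (hX : IsInControl P ℱ μ G X Z) (hS : IsLayout ℱ q lr X Z S)
    (hint : ∀ k, ∫⁻ x, ENNReal.ofReal (lr k x) ∂μ k ≤ 1) (hK : 0 < K) (r : ℕ) (A : ℝ) :
    ENNReal.ofReal (A / K) ≤ ∫⁻ ω, (T lr X S r A ω : ℝ≥0∞) ∂P := by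
  set Y : ℕ → Ω → ℝ := fun t ω => ∑ k, R lr X S k t ω with hYdef
  have hR := measurable_R hlr hX hS
  have hR' : ∀ k t, Measurable (R lr X S k t) := fun k t => (hR k t).mono (ℱ.le t) le_rfl
  have hR0 := R_nonneg hlr0 X S
  have hY : ∀ t, Measurable[ℱ t] (Y t) := fun t =>
    Finset.measurable_sum _ fun k _ => hR k t
  have hYint : ∀ (E : Set Ω) t, ∫⁻ ω in E, ENNReal.ofReal (Y t ω) ∂P =
      ∑ k, ∫⁻ ω in E, ENNReal.ofReal (R lr X S k t ω) ∂P := by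
    intro E t
    rw [← lintegral_finsetSum _ fun k _ => (hR' k t).ennreal_ofReal]
    exact lintegral_congr fun ω => ENNReal.ofReal_sum_of_nonneg fun k _ => hR0 k t ω
  have hmain : ENNReal.ofReal A ≤ K * ∑' t, P (below Y A t) := by
    refine ofReal_le_mul_tsum_below P hY (fun ω => Finset.sum_eq_zero fun k _ => rfl)
      (by exact_mod_cast hK.ne') fun t => ?_
    rw [hYint, hYint]
    calc _ ≤ ∑ k, (∫⁻ ω in below Y A t, ENNReal.ofReal (R lr X S k t ω) ∂P + P (below Y A t)) :=
          Finset.sum_le_sum fun k _ => setLIntegral_R_succ_le hlr hlr0 hX hS k (hint k) t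
            (measurableSet_below hY A t)
      _ = _ := by simp [Finset.sum_add_distrib]
  calc ENNReal.ofReal (A / K) = ENNReal.ofReal A / K := by
        rw [ENNReal.ofReal_div_of_pos (by exact_mod_cast hK), ENNReal.ofReal_natCast]
    _ ≤ ∑' t, P (below Y A t) := ENNReal.div_le_of_le_mul' hmain
    _ = ∫⁻ ω, ∑' t, (below Y A t).indicator (1 : Ω → ℝ≥0∞) ω ∂P := (lintegral_tsum_below P hY A).symm
    _ ≤ _ := lintegral_mono fun ω => tsum_below_le_hittingTime fun t ht =>
        ht.trans (topSum_le_sum r fun k => hR0 k t ω)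

/-- The potential is taken at level `A + 1` because the observation acts on `R + 1`, which is below
`A + 1` as long as `R` is below `A`. -/
theorem lintegral_T_le_of_isPotential [IsProbabilityMeasure P] (hlr : ∀ k, Measurable (lr k))
    (hlr0 : ∀ k x, 0 ≤ lr k x) (hX : IsInControl P ℱ μ G X Z) (hS : IsLayout ℱ q lr X Z S)
    {r : ℕ} (hr : 1 ≤ r) {A : ℝ} (hA : 0 < A) {k : Fin K} {M : ℝ≥0∞} {V : ℝ → ℝ≥0∞}
    (hV : IsPotential (μ k) (lr k) (A + 1) M V) :
    ∫⁻ ω, (T lr X S r A ω : ℝ≥0∞) ∂P ≤ 2 * M := by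
  have hR := measurable_R hlr hX hS k
  have hR0 := R_nonneg hlr0 X S
  calc _ ≤ ∫⁻ ω, ∑' t, (below (R lr X S k) A t).indicator (1 : Ω → ℝ≥0∞) ω ∂P :=
        lintegral_mono fun ω => hittingTime_le_tsum_below fun t ht =>
          ht.trans (le_topSum hr (fun k => hR0 k t ω) k)
    _ = ∑' t, P (below (R lr X S k) A t) := lintegral_tsum_below P hR A
    _ ≤ 2 * M := by
        refine tsum_below_le_two_mul P hR hV.le_bound fun t =>
          hV.le_setLIntegral_R_succ hlr hlr0 hX hS t (measurableSet_below hR A t) fun ω hω => ?_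
        -- `below` says nothing about time 0, where `R = 0` and `0 < A` are used instead.
        rcases t.eq_zero_or_pos with rfl | ht
        · have : R lr X S k 0 ω = 0 := rfl
          linarith
        · linarith [hω t ht le_rfl]

end Streams

end TSSRP

theorem theorem2 {K : ℕ} {𝒳 Ω Θ : Type*} [MeasurableSpace 𝒳] {mΩ : MeasurableSpace Ω}
    (P : Measure Ω) [IsProbabilityMeasure P] (ℱ : Filtration ℕ mΩ)
    (m : Measure 𝒳) [SigmaFinite m]
    (f : Θ → 𝒳 → ℝ) (hf : ∀ θ, TSSRP.IsDensity m (f θ)) (θ₀ θ₁ : Fin K → Θ)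
    (G : Fin K → Measure ℝ) [∀ k, IsProbabilityMeasure (G k)]
    (X : Fin K → ℕ → Ω → 𝒳) (Z : Fin K → ℕ → Ω → ℝ) (S : ℕ → Ω → Finset (Fin K))
    (lr : Fin K → 𝒳 → ℝ) (hlr : ∀ k x, lr k x = f (θ₁ k) x / f (θ₀ k) x)
    (hX : TSSRP.IsInControl P ℱ (fun k => TSSRP.law m (f (θ₀ k))) G X Z)
    (q : ℕ) (hS : TSSRP.IsLayout ℱ q lr X Z S)
    (r : ℕ) (hr : 1 ≤ r) (hrK : r ≤ K) :
    (∀ A : ℝ, ENNReal.ofReal (A / K) ≤ ∫⁻ ω, (TSSRP.T lr X S r A ω : ℝ≥0∞) ∂P) ∧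
    ((∃ k, klDiv (TSSRP.law m (f (θ₁ k))) (TSSRP.law m (f (θ₀ k))) ≠ ∞) →
      ∃ C : ℝ≥0, ∀ᶠ A : ℝ in atTop,
        ∫⁻ ω, (TSSRP.T lr X S r A ω : ℝ≥0∞) ∂P ≤ C * ENNReal.ofReal A) := by
  obtain rfl : lr = fun k x => f (θ₁ k) x / f (θ₀ k) x := by
    ext k x
    exact hlr k x
  have hlrm : ∀ k, Measurable fun x => f (θ₁ k) x / f (θ₀ k) x := fun k =>
    (hf (θ₁ k)).measurable.div (hf (θ₀ k)).measurable
  have hlr0 : ∀ k x, 0 ≤ f (θ₁ k) x / f (θ₀ k) x := fun k x =>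
    div_nonneg ((hf (θ₁ k)).nonneg x) ((hf (θ₀ k)).nonneg x)
  refine ⟨fun A => TSSRP.ofReal_div_le_lintegral_T hlrm hlr0 hX hS
    (fun k => TSSRP.lintegral_ratio_le_one (hf (θ₀ k)) (hf (θ₁ k))) (by omega) r A, ?_⟩
  rintro ⟨k, hk⟩
  obtain ⟨C, hC0, hC⟩ := TSSRP.exists_isPotential (hf (θ₀ k)) (hf (θ₁ k)) hk
  -- The bound is `2 * C * (A + 1)`, and `A + 1 ≤ 2 * A` once `A ≥ 1`.
  refine ⟨(4 * C).toNNReal, ?_⟩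
  filter_upwards [eventually_ge_atTop 1] with A hA
  obtain ⟨V, hV⟩ := hC (A + 1) (by linarith)
  refine (TSSRP.lintegral_T_le_of_isPotential hlrm hlr0 hX hS hr (by linarith) hV).trans ?_
  have h2 : (2 : ℝ≥0∞) = ENNReal.ofReal 2 := by simp
  have h4 : (((4 * C).toNNReal : ℝ≥0) : ℝ≥0∞) = ENNReal.ofReal (4 * C) := rfl
  rw [h2, h4, ← ENNReal.ofReal_mul zero_le_two, ← ENNReal.ofReal_mul (by linarith)]
  exact ENNReal.ofReal_le_ofReal (by nlinarith)
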